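/- Let $p>3$ be prime and $0\le m\le p-1$. For $z$ in the upper half-plane write $q^x=e^{2\pi i xz}$, $(x_1,x_2,x_3;q^N)_\infty=\prod_{i=1}^{3}\prod_{n\ge 0}(1-x_iq^{Nn})$, and $\eta(z)=q^{1/24}\prod_{n\ge1}(1-q^n)$. For $N\ge 1$ and $0<\rho<N$ put $$f_{N,\rho}(z)=q^{(N-2\rho)^2/(8N)}\,(q^{\rho},q^{N-\rho},q^N;q^N)_\infty,$$ and extend this to all integers $\rho$ with $N\nmid\rho$ by $f_{N,\rho+N}=f_{N,\rho}$ (so that also $f_{N,-\rho}=f_{N,\rho}$). For an integer vector $\overrightarrow n=(n_0,n_1,\dots,n_{(p-1)/2})$ put $$j(p,\overrightarrow n,z)=\eta(pz)^{n_0}\prod_{k=1}^{(p-1)/2}f_{p,k}(z)^{n_k}.$$ For an integer $m$ let $\mathfrak F(m,p)$ be the set of functions $z\mapsto j(p,\overrightarrow n,z)$ on the upper half-plane for which $$\text{(1) } n_0+\sum_{k=1}^{(p-1)/2}n_k=2,\qquad \text{(2) } \sum_{k=1}^{(p-1)/2}k^2n_k\equiv 2m \pmod p,\qquad \text{(3)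 } n_0+3\sum_{k=1}^{(p-1)/2}n_k\equiv 0\pmod{24}.$$ For $1\le r\le\frac12(p-1)$ let $\pi_r$ be the permutation of $\{1,\dots,\frac12(p-1)\}$ with $\pi_r(i)=i'$, where $ri'\equiv\pm i\pmod p$, and let $\pi_r(\overrightarrow n)=(n_0,n_{\pi_r(1)},\dots,n_{\pi_r((p-1)/2)})$. For $A=\begin{pmatrix}a&b\\c&d\end{pmatrix}\in \mathrm{SL}_2(\mathbb Z)$ put $(F\,|\,[A]_1)(z)=(cz+d)^{-1}F\!\left(\frac{az+b}{cz+d}\right)$. Suppose $j(p,\overrightarrow n,\cdot)\in\mathfrak F(m,p)$. Then: (i) For every $A=\begin{pmatrix}a&b\\p&d\end{pmatrix}\in\Gamma_0(p)$ with $1\le a,d\le p-1$, and all $z$ in the upper half-plane, $$\bigl(j(p,\overrightarrow n,\cdot)\,|\,[A]_1\bigr)(z)=(-1)^{L(\overrightarrow n,a,b,p)}\exp\!\left(\frac{2\pi i abm}{p}\right)\eta(pz)^{n_0}\prod_{k=1}^{(p-1)/2}f_{p,ka}(z)^{n_k},$$ where $$L(\overrightarrow n,a,b,p)=b(a+1)\sum_{k=1}^{(p-1)/2}k\,n_k+\sum_{k=1}^{(p-1)/2}\left\lfloor\frac{ka}{p}\right\rfloor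 n_k .$$ (ii) For every $1\le r\le\frac12(p-1)$ and every integer $m'\equiv r^2m\pmod p$, $j(p,\pi_r(\overrightarrow n),\cdot)\in\mathfrak F(m',p)$. -/

import Mathlib

open scoped ModularForm MatrixGroups

noncomputable section

/-- `q ^ x = exp (2 π i x z)`, for a point `z` of the upper half-plane. -/
def qPow (x : ℂ) (z : UpperHalfPlane) : ℂ :=
  Complex.exp (2 * Real.pi * Complex.I * x * z)

/-- The `q`-Pochhammer symbol `(a; q)_∞ = ∏_{n ≥ 0} (1 - a q ^ n)`. -/
def qPoch (a q : ℂ) : ℂ :=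
  ∏' n : ℕ, (1 - a * q ^ n)

/-- Biagioli's theta function `f_{N,ρ}`. With `s` the residue of `ρ` modulo `N`, so that `0 < s < N`
when `N ∤ ρ`, it is `q ^ ((N - 2 s) ^ 2 / (8 N)) (q ^ s, q ^ (N - s), q ^ N; q ^ N)_∞`.
In particular it is periodic in `ρ` with period `N`. -/
def biagioliF (N : ℕ) (ρ : ℤ) (z : UpperHalfPlane) : ℂ :=
  let s : ℤ := ρ % (N : ℤ)
  qPow (((N : ℂ) - 2 * (s : ℂ)) ^ 2 / (8 * (N : ℂ))) z
    * (qPoch (qPow (s : ℂ) z) (qPow (N : ℂ) z)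
      * qPoch (qPow ((N : ℂ) - (s : ℂ)) z) (qPow (N : ℂ) z)
      * qPoch (qPow (N : ℂ) z) (qPow (N : ℂ) z))

/-- `f_{N,N+ρ} = f_{N,ρ}`. -/
theorem biagioliF_add (N : ℕ) (ρ : ℤ) (z : UpperHalfPlane) :
    biagioliF N ((N : ℤ) + ρ) z = biagioliF N ρ z := by
  simp [biagioliF]

/-- `f_{N,-ρ} = f_{N,ρ}` for `N ∤ ρ`. -/
theorem biagioliF_neg (N : ℕ) (ρ : ℤ) (h : ¬ (N : ℤ) ∣ ρ) (z : UpperHalfPlane) :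
    biagioliF N (-ρ) z = biagioliF N ρ z := by
  have h1 : (-ρ) % (N : ℤ) = (N : ℤ) - ρ % (N : ℤ) := by
    rw [Int.neg_emod, if_neg h]
    simp
  simp only [biagioliF, h1]
  push_cast
  have e1 : ((N : ℂ) - ((N : ℂ) - ((ρ % (N : ℤ) : ℤ) : ℂ))) = ((ρ % (N : ℤ) : ℤ) : ℂ) := by ring
  have e2 : ((N : ℂ) - 2 * ((N : ℂ) - ((ρ % (N : ℤ) : ℤ) : ℂ))) ^ 2
      = ((N : ℂ) - 2 * ((ρ % (N : ℤ) : ℤ) : ℂ)) ^ 2 := by ring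
  rw [e1, e2]
  ring

/-- Exponent vectors `(n_0, n_1, …, n_{(p-1)/2})`: the entry `n_k` with `1 ≤ k ≤ (p-1)/2` is
`n i.succ` for the index `i : Fin ((p - 1) / 2)` with `k = i + 1`. -/
abbrev ExpVec (p : ℕ) : Type := Fin ((p - 1) / 2 + 1) → ℤ

/-- The generalized eta-quotient `j(p, n, z) = η(pz)^{n_0} ∏_k f_{p,k}(z)^{n_k}`. -/
def genEtaQuot (p : ℕ) (n : ExpVec p) (z : UpperHalfPlane) : ℂ :=
  ModularForm.eta ((p : ℂ) * (z : ℂ)) ^ n 0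
    * ∏ i : Fin ((p - 1) / 2), biagioliF p ((i : ℕ) + 1 : ℤ) z ^ n i.succ

/-- The three conditions on the exponents:
`n_0 + ∑ n_k = 2`, `∑ k² n_k ≡ 2m (mod p)` and `n_0 + 3 ∑ n_k ≡ 0 (mod 24)`. -/
def ModularityConditions (m : ℤ) (p : ℕ) (n : ExpVec p) : Prop :=
  n 0 + ∑ i : Fin ((p - 1) / 2), n i.succ = 2 ∧
  (∑ i : Fin ((p - 1) / 2), ((i : ℕ) + 1 : ℤ) ^ 2 * n i.succ) ≡ 2 * m [ZMOD (p : ℤ)] ∧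
  (n 0 + 3 * ∑ i : Fin ((p - 1) / 2), n i.succ) ≡ 0 [ZMOD 24]

/-- The set `𝔉(m, p)` of the functions `j(p, n, ·)` whose exponents satisfy the conditions. -/
def frakF (m : ℤ) (p : ℕ) : Set (UpperHalfPlane → ℂ) :=
  {F | ∃ n : ExpVec p, ModularityConditions m p n ∧ F = genEtaQuot p n}

/-- The parity exponent `L(n, a, b, p) = b (a + 1) ∑ k n_k + ∑ ⌊k a / p⌋ n_k`
(integer division rounds down here, the divisor being positive). -/
def parityL (p : ℕ) (n : ExpVec p) (a b : ℤ) : ℤ :=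
  b * (a + 1) * ∑ i : Fin ((p - 1) / 2), ((i : ℕ) + 1 : ℤ) * n i.succ
    + ∑ i : Fin ((p - 1) / 2), (((i : ℕ) + 1 : ℤ) * a / (p : ℤ)) * n i.succ

/-- `k' = i' + 1` satisfies `r k' ≡ ± k (mod p)`, where `k = i + 1`. -/
def PiRel (p r : ℕ) (i i' : Fin ((p - 1) / 2)) : Prop :=
  (r : ℤ) * ((i' : ℕ) + 1 : ℤ) ≡ ((i : ℕ) + 1 : ℤ) [ZMOD (p : ℤ)] ∨
  (r : ℤ) * ((i' : ℕ) + 1 : ℤ) ≡ -((i : ℕ) + 1 : ℤ) [ZMOD (p : ℤ)]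

open Classical in
/-- The permutation `π_r` of `{1, …, (p-1)/2}`: `π_r(k)` is the `k'` with `r k' ≡ ± k (mod p)`.
It exists, is unique, and `π_r` is a bijection, whenever `p` is an odd prime and `p ∤ r`. -/
def piPerm (p r : ℕ) (i : Fin ((p - 1) / 2)) : Fin ((p - 1) / 2) :=
  if h : ∃ i', PiRel p r i i' then h.choose else i

theorem piRel_exists {p r : ℕ} (hp : p.Prime) (hp2 : 2 < p) (hr : ¬ p ∣ r)
    (i : Fin ((p - 1) / 2)) : ∃ i', PiRel p r i i' := by
  have : Fact p.Prime := ⟨hp⟩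
  have : NeZero p := ⟨hp.ne_zero⟩
  have hodd : p % 2 = 1 := (hp.eq_two_or_odd).resolve_left (by omega)
  have hr0 : (r : ZMod p) ≠ 0 := fun h => hr ((ZMod.natCast_eq_zero_iff r p).1 h)
  have hi0 : ((i.val + 1 : ℕ) : ZMod p) ≠ 0 := fun h => by
    have := Nat.le_of_dvd (by omega) ((ZMod.natCast_eq_zero_iff _ p).1 h)
    have := i.isLt
    omega
  set x : ZMod p := ((i.val + 1 : ℕ) : ZMod p) / (r : ZMod p) with hx
  have hx0 : x ≠ 0 := div_ne_zero hi0 hr0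
  have hrx : (r : ZMod p) * x = ((i.val + 1 : ℕ) : ZMod p) := by
    rw [hx]; field_simp
  have hle : x.valMinAbs.natAbs ≤ p / 2 := ZMod.natAbs_valMinAbs_le x
  have hpos : x.valMinAbs.natAbs ≠ 0 := by
    rw [Int.natAbs_ne_zero, Ne, ZMod.valMinAbs_eq_zero]; exact hx0
  refine ⟨⟨x.valMinAbs.natAbs - 1, by omega⟩, ?_⟩
  have hv : (((x.valMinAbs.natAbs - 1 : ℕ) : ℤ) + 1) = (x.valMinAbs.natAbs : ℤ) := by omega
  unfold PiRel
  simp only [hv]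
  rw [← ZMod.intCast_eq_intCast_iff, ← ZMod.intCast_eq_intCast_iff]
  push_cast at hrx
  rcases Int.natAbs_eq x.valMinAbs with h | h
  · left
    rw [← h]
    push_cast
    rw [hrx]
  · right
    have h' : (x.valMinAbs.natAbs : ℤ) = - x.valMinAbs := by omega
    rw [h']
    push_cast
    rw [mul_neg, hrx]

theorem piPerm_spec {p r : ℕ} (hp : p.Prime) (hp2 : 2 < p) (hr : ¬ p ∣ r)
    (i : Fin ((p - 1) / 2)) : PiRel p r i (piPerm p r i) := by
  rw [piPerm, dif_pos (piRel_exists hp hp2 hr i)]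
  exact (piRel_exists hp hp2 hr i).choose_spec

theorem piRel_unique {p r : ℕ} (hp : p.Prime) (hr : ¬ p ∣ r)
    {i i₁ i₂ : Fin ((p - 1) / 2)} (h₁ : PiRel p r i i₁) (h₂ : PiRel p r i i₂) : i₁ = i₂ := by
  have hpr : Prime (p : ℤ) := Nat.prime_iff_prime_int.1 hp
  have hr' : ¬ (p : ℤ) ∣ (r : ℤ) := fun h => hr (Int.natCast_dvd_natCast.1 h)
  have l₁ := i₁.isLt
  have l₂ := i₂.isLt
  have key : (p : ℤ) ∣ ((i₁ : ℕ) : ℤ) - ((i₂ : ℕ) : ℤ) ∨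
      (p : ℤ) ∣ ((i₁ : ℕ) : ℤ) + ((i₂ : ℕ) : ℤ) + 2 := by
    rcases h₁ with h₁ | h₁ <;> rcases h₂ with h₂ | h₂
    · left
      refine (hpr.dvd_or_dvd ?_).resolve_left hr'
      convert (dvd_sub h₂.dvd h₁.dvd) using 1; ring
    · right
      refine (hpr.dvd_or_dvd ?_).resolve_left hr'
      convert (dvd_neg.2 (dvd_add h₂.dvd h₁.dvd)) using 1; ring
    · right
      refine (hpr.dvd_or_dvd ?_).resolve_left hr'
      convert (dvd_neg.2 (dvd_add h₂.dvd h₁.dvd)) using 1; ring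
    · left
      refine (hpr.dvd_or_dvd ?_).resolve_left hr'
      convert (dvd_sub h₂.dvd h₁.dvd) using 1; ring
  rcases key with h | h
  · have := Int.eq_zero_of_abs_lt_dvd h (by rw [abs_lt]; constructor <;> omega)
    exact Fin.ext (by omega)
  · have := Int.le_of_dvd (by omega) h
    omega

theorem piPerm_bijective {p r : ℕ} (hp : p.Prime) (hp2 : 2 < p) (hr : ¬ p ∣ r) :
    Function.Bijective (piPerm p r) := by
  refine Finite.injective_iff_bijective.1 fun i j hij => ?_
  have h₁ := piPerm_spec hp hp2 hr i
  have h₂ := piPerm_spec hp hp2 hr j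
  rw [hij] at h₁
  have l₁ := i.isLt
  have l₂ := j.isLt
  have key : (p : ℤ) ∣ ((i : ℕ) : ℤ) - ((j : ℕ) : ℤ) ∨
      (p : ℤ) ∣ ((i : ℕ) : ℤ) + ((j : ℕ) : ℤ) + 2 := by
    rcases h₁ with h₁ | h₁ <;> rcases h₂ with h₂ | h₂
    all_goals
      obtain ⟨x, hx⟩ := h₁.dvd
      obtain ⟨y, hy⟩ := h₂.dvd
    · exact Or.inl ⟨x - y, by linear_combination hx - hy⟩
    · exact Or.inr ⟨x - y, by linear_combination hx - hy⟩
    · exact Or.inr ⟨y - x, by linear_combination hy - hx⟩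
    · exact Or.inl ⟨y - x, by linear_combination hy - hx⟩
  rcases key with h | h
  · have := Int.eq_zero_of_abs_lt_dvd h (by rw [abs_lt]; constructor <;> omega)
    exact Fin.ext (by omega)
  · have := Int.le_of_dvd (by omega) h
    omega

/-- The vector `π_r(n) = (n_0, n_{π_r(1)}, …, n_{π_r((p-1)/2)})`. -/
def permVec (p r : ℕ) (n : ExpVec p) : ExpVec p :=
  Fin.cons (n 0) fun i => n (piPerm p r i).succ

end

/-!
The transformation law is that of a Jacobi form without multiplier. The function
`φ(v) = kleinTheta τ v` is the Jacobi theta function `θ₁(v | τ)` divided by `η(τ) ^ 3`, up to a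
constant. It is entire in `v`, quasi-periodic for the lattice `ℤ τ + ℤ`, has simple zeros at the
lattice points and no others, and has the same derivative `-2 π i` at the origin for every `τ`.
Hence, for `A = (a, b; c, d)` in `SL(2, ℤ)` and `w = c τ + d`, the functions `φ(A τ, v / w)` and
`e ^ (π i c v ^ 2 / w) φ(τ, v)` of `v` have the same factors of quasi-periodicity and the same
simple zeros, so their quotient is a doubly periodic entire function, that is, a constant; the
derivatives at `v = 0` show that it is `1 / w` (`kleinTheta_SL_smul`).

Since `f_{N,ρ}(z) = ± e ^ (π i ρ ^ 2 z / N) η(N z) ^ 3 φ(N z, ρ z)` (`biagioliF_eq_kleinTheta`),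
evaluating this law at the conjugate of `A ∈ Γ₀(N)` by `diag(N, 1)` gives
`f_{N,ρ}(A z) = ζ w⁻¹ X ^ 3 f_{N,aρ}(z)` with an explicit root of unity `ζ` and
`X = η(N A z) / η(N z)` (`biagioliF_SL_smul`). For `N = p` and `S = ∑ n_k`, a generalized
eta-quotient therefore picks up the factor `X ^ (n₀ + 3 S) w ^ (-S)`. The precise multiplier of `η`
is not needed: `24 ∣ n₀ + 3 S`, and `X ^ 24 = w ^ 12` by the modularity of the discriminant, so
that this factor is `w ^ ((n₀ + S) / 2) = w` (`genEtaQuot_slash`). The product of the roots of unity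
`ζ` is `prod_root_of_unity`.

The set `frakF m p` consists of functions, so the conditions on the exponents have to be read off
from the function. This is possible because the factors `η(p z)` and `f_{p,k}` are multiplicatively
independent (`genEtaQuot_injective`): their logarithms on the imaginary axis are
`c log t - t ^ k + o(t ^ k)` as `t = e ^ (2 π i z) → 0`, with distinct exponents `k`. The statement
on `π_r` is then a reindexing of sums (`modularityConditions_permVec`).
-/

noncomputable section

open Complex Filter Topology
open UpperHalfPlane hiding I
open scoped Real

/-! ### The `q`-Pochhammer symbol as a function of its first argument -/

lemma summable_norm_mul_pow (x : ℂ) {q : ℂ} (hq : ‖q‖ < 1) :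
    Summable fun n : ℕ => ‖-(x * q ^ n)‖ := by
  simpa using (summable_geometric_of_lt_one (norm_nonneg q) hq).mul_left ‖x‖

lemma multipliable_qPoch (x : ℂ) {q : ℂ} (hq : ‖q‖ < 1) :
    Multipliable fun n : ℕ => 1 - x * q ^ n := by
  simpa [sub_eq_add_neg] using multipliable_one_add_of_summable (summable_norm_mul_pow x hq)

lemma qPoch_eq_one_sub_mul (x : ℂ) {q : ℂ} (hq : ‖q‖ < 1) :
    qPoch x q = (1 - x) * qPoch (x * q) q := by
  have e : ∀ n : ℕ, 1 - x * q * q ^ n = 1 - x * q ^ (n + 1) := fun n => by ring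
  have h : Multipliable fun n : ℕ => 1 - x * q ^ (n + 1) :=
    (multipliable_qPoch (x * q) hq).congr e
  have h0 := h.hasProd.zero_mul (f := fun n : ℕ => 1 - x * q ^ n)
  rw [qPoch, h0.tprod_eq, pow_zero, mul_one, qPoch, tprod_congr e]

lemma qPoch_ne_zero {x q : ℂ} (hq : ‖q‖ < 1) (h : ∀ n : ℕ, x * q ^ n ≠ 1) :
    qPoch x q ≠ 0 := by
  have := tprod_one_add_ne_zero_of_summable (f := fun n : ℕ => -(x * q ^ n))
    (fun n => by rw [← sub_eq_add_neg]; exact sub_ne_zero.2 (h n).symm) (summable_norm_mul_pow x hq)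
  simpa [qPoch, sub_eq_add_neg] using this

lemma qPoch_self_ne_zero {q : ℂ} (hq : ‖q‖ < 1) : qPoch q q ≠ 0 := by
  refine qPoch_ne_zero hq fun n h => ?_
  have h1 : ‖q‖ ^ (n + 1) = 1 := by simpa [pow_succ'] using congrArg norm h
  exact (pow_lt_one₀ (norm_nonneg q) hq n.succ_ne_zero).ne h1

lemma differentiable_qPoch {q : ℂ} (hq : ‖q‖ < 1) : Differentiable ℂ fun x => qPoch x q := by
  have h : HasProdLocallyUniformlyOn (fun (n : ℕ) (x : ℂ) => 1 + -(x * q ^ n))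
      (fun x => ∏' n : ℕ, (1 + -(x * q ^ n))) Set.univ := by
    refine hasProdLocallyUniformlyOn_of_forall_compact isOpen_univ fun K _ hK => ?_
    obtain ⟨R, hR⟩ := hK.isBounded.exists_norm_le
    refine ((summable_geometric_of_lt_one (norm_nonneg q) hq).mul_left
      R).hasProdUniformlyOn_nat_one_add hK (.of_forall fun n x hx => ?_) fun n => by fun_prop
    simpa using mul_le_mul_of_nonneg_right (hR x hx) (by positivity)
  rw [← differentiableOn_univ]
  have h2 := h.differentiableOn (.of_forall fun s => by
    simpa [Finset.prod_fn] using
      DifferentiableOn.finsetProd (fun _ _ => by fun_prop)) isOpen_univ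
  simpa [qPoch, sub_eq_add_neg] using h2

/-! ### The normalized theta function -/

/-- The nome `e ^ (2 π i τ)`. -/
def nome (τ : ℍ) : ℂ := cexp (2 * π * I * τ)

/-- The odd entire function
`e ^ (-π i v) ∏_{n ≥ 0} (1 - x Q ^ n) ∏_{n ≥ 1} (1 - Q ^ n / x) / ∏_{n ≥ 1} (1 - Q ^ n) ^ 2` of `v`,
where `x = e ^ (2 π i v)` and `Q = e ^ (2 π i τ)`. Up to a constant factor it is the quotient
`θ₁(v | τ) / η(τ) ^ 3`, normalized by `φ(v) = -2 π i v + O(v ^ 2)`. -/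
def kleinTheta (τ : ℍ) (v : ℂ) : ℂ :=
  cexp (-(π * I * v)) * (qPoch (cexp (2 * π * I * v)) (nome τ)
    * qPoch (nome τ * cexp (-(2 * π * I * v))) (nome τ)) / qPoch (nome τ) (nome τ) ^ 2

lemma norm_nome_lt_one (τ : ℍ) : ‖nome τ‖ < 1 := norm_exp_two_pi_I_lt_one τ

lemma qPoch_nome_ne_zero (τ : ℍ) : qPoch (nome τ) (nome τ) ≠ 0 :=
  qPoch_self_ne_zero (norm_nome_lt_one τ)

lemma differentiable_kleinTheta (τ : ℍ) : Differentiable ℂ (kleinTheta τ) := by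
  have h := differentiable_qPoch (norm_nome_lt_one τ)
  refine Differentiable.div_const (.mul (by fun_prop) (.mul ?_ ?_)) _
  · exact h.comp (f := fun v : ℂ => cexp (2 * π * I * v)) (by fun_prop)
  · exact h.comp (f := fun v : ℂ => nome τ * cexp (-(2 * π * I * v))) (by fun_prop)

lemma kleinTheta_zero (τ : ℍ) : kleinTheta τ 0 = 0 := by
  simp [kleinTheta, qPoch_eq_one_sub_mul 1 (norm_nome_lt_one τ)]

lemma hasDerivAt_kleinTheta_zero (τ : ℍ) : HasDerivAt (kleinTheta τ) (-(2 * π * I)) 0 := by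
  have h := differentiable_qPoch (norm_nome_lt_one τ)
  -- Split off the factor `1 - x`, which carries the simple zero at the origin.
  set g : ℂ → ℂ := fun v => cexp (-(π * I * v)) * (qPoch (cexp (2 * π * I * v) * nome τ) (nome τ)
    * qPoch (nome τ * cexp (-(2 * π * I * v))) (nome τ)) / qPoch (nome τ) (nome τ) ^ 2 with hg
  have hgd : DifferentiableAt ℂ g 0 := by
    refine (Differentiable.div_const (.mul (by fun_prop) (.mul ?_ ?_)) _) 0
    · exact h.comp (f := fun v : ℂ => cexp (2 * π * I * v) * nome τ) (by fun_prop)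
    · exact h.comp (f := fun v : ℂ => nome τ * cexp (-(2 * π * I * v))) (by fun_prop)
  have hg0 : g 0 = 1 := by
    have := qPoch_nome_ne_zero τ
    simp only [hg, mul_zero, neg_zero, Complex.exp_zero, one_mul, mul_one]
    field_simp
  have heq : kleinTheta τ = fun v => (1 - cexp (2 * π * I * v)) * g v := by
    funext v
    rw [kleinTheta, qPoch_eq_one_sub_mul (cexp (2 * π * I * v)) (norm_nome_lt_one τ), hg]
    ring
  have h1 : HasDerivAt (fun v : ℂ => 1 - cexp (2 * π * I * v)) (-(2 * π * I)) 0 := by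
    have h2 : HasDerivAt (fun v : ℂ => 2 * π * I * v) (2 * π * I) 0 := by
      simpa using (hasDerivAt_id (0 : ℂ)).const_mul (2 * π * I)
    simpa using h2.cexp.const_sub 1
  rw [heq]
  simpa [hg0] using h1.fun_mul hgd.hasDerivAt

lemma kleinTheta_add_one (τ : ℍ) (v : ℂ) : kleinTheta τ (v + 1) = -kleinTheta τ v := by
  have h1 : cexp (2 * π * I * (v + 1)) = cexp (2 * π * I * v) := by
    rw [mul_add, mul_one, Complex.exp_add, Complex.exp_two_pi_mul_I, mul_one]
  have h2 : cexp (-(2 * π * I * (v + 1))) = cexp (-(2 * π * I * v)) := by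
    rw [Complex.exp_neg, h1, Complex.exp_neg]
  have h3 : cexp (-(π * I * (v + 1))) = -cexp (-(π * I * v)) := by
    rw [Complex.exp_neg, mul_add, mul_one, Complex.exp_add, Complex.exp_pi_mul_I, Complex.exp_neg,
      mul_neg_one, inv_neg]
  rw [kleinTheta, h1, h2, h3, kleinTheta]
  ring

lemma kleinTheta_add_tau (τ : ℍ) (v : ℂ) :
    kleinTheta τ (v + τ) = -cexp (-(π * I * τ) - 2 * π * I * v) * kleinTheta τ v := by
  have hq := norm_nome_lt_one τ
  have h1 : cexp (2 * π * I * (v + τ)) = cexp (2 * π * I * v) * nome τ := by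
    rw [nome, ← Complex.exp_add]; ring_nf
  have h2 : nome τ * cexp (-(2 * π * I * (v + τ))) = cexp (-(2 * π * I * v)) := by
    rw [nome, ← Complex.exp_add]; ring_nf
  have h3 : cexp (-(π * I * (v + τ))) * (1 - cexp (-(2 * π * I * v)))
      = -cexp (-(π * I * τ) - 2 * π * I * v) * cexp (-(π * I * v))
        * (1 - cexp (2 * π * I * v)) := by
    simp only [mul_sub, mul_one, neg_mul, ← Complex.exp_add]
    ring_nf
  rw [kleinTheta, h1, h2, qPoch_eq_one_sub_mul (cexp (-(2 * π * I * v))) hq, kleinTheta,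
    qPoch_eq_one_sub_mul (cexp (2 * π * I * v)) hq, mul_comm (cexp (-(2 * π * I * v))) (nome τ)]
  linear_combination (qPoch (cexp (2 * π * I * v) * nome τ) (nome τ)
    * qPoch (nome τ * cexp (-(2 * π * I * v))) (nome τ) / qPoch (nome τ) (nome τ) ^ 2) * h3

lemma kleinTheta_add_int (τ : ℍ) (v : ℂ) (n : ℤ) :
    kleinTheta τ (v + n) = (-1) ^ n * kleinTheta τ v := by
  induction n using Int.induction_on with
  | zero => simp
  | succ k ih =>
    rw [zpow_add_one₀ (by norm_num)]
    push_cast at ih ⊢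
    rw [← add_assoc, kleinTheta_add_one, ih]
    ring
  | pred k ih =>
    have h := kleinTheta_add_one τ (v + ((-k - 1 : ℤ) : ℂ))
    rw [zpow_sub_one₀ (by norm_num), mul_assoc, mul_comm _ (kleinTheta τ v), ← mul_assoc, ← ih]
    rw [add_assoc] at h
    push_cast at h ⊢
    rw [sub_add_cancel] at h
    rw [h]
    norm_num

lemma kleinTheta_add_int_mul_tau (τ : ℍ) (v : ℂ) (m : ℤ) :
    kleinTheta τ (v + m * τ)
      = (-1) ^ m * cexp (-(π * I * m ^ 2 * τ) - 2 * π * I * m * v) * kleinTheta τ v := by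
  induction m using Int.induction_on with
  | zero => simp
  | succ k ih =>
    have h := kleinTheta_add_tau τ (v + k * τ)
    rw [zpow_add_one₀ (by norm_num)]
    push_cast at ih ⊢
    rw [add_one_mul, ← add_assoc, h, ih]
    rw [show -(π * I * ((k : ℂ) + 1) ^ 2 * τ) - 2 * π * I * (k + 1) * v
      = (-(π * I * τ) - 2 * π * I * (v + k * τ)) + (-(π * I * (k : ℂ) ^ 2 * τ) - 2 * π * I * k * v)
      by ring, Complex.exp_add]
    ring
  | pred k ih =>
    have h := kleinTheta_add_tau τ (v + ((-k - 1 : ℤ) : ℂ) * τ)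
    rw [zpow_sub_one₀ (by norm_num)]
    push_cast at h ih ⊢
    rw [show v + (-(k : ℂ) - 1) * τ + τ = v + -(k : ℂ) * τ by ring, ih] at h
    have e : cexp (-(π * I * (-(k : ℂ)) ^ 2 * τ) - 2 * π * I * -(k : ℂ) * v)
        = cexp (-(π * I * τ) - 2 * π * I * (v + (-(k : ℂ) - 1) * τ))
          * cexp (-(π * I * (-(k : ℂ) - 1) ^ 2 * τ) - 2 * π * I * (-(k : ℂ) - 1) * v) := by
      rw [← Complex.exp_add]; ring_nf
    rw [e] at h
    have hne := Complex.exp_ne_zero (-(π * I * τ) - 2 * π * I * (v + (-(k : ℂ) - 1) * τ))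
    apply mul_left_cancel₀ (neg_ne_zero.2 hne)
    rw [← h]
    norm_num
    ring

/-- `φ(v + m τ + n) = (-1) ^ (m + n) e ^ (-π i m ^ 2 τ - 2 π i m v) φ(v)`. -/
lemma kleinTheta_add_lattice (τ : ℍ) (v : ℂ) (m n : ℤ) :
    kleinTheta τ (v + (m * τ + n))
      = (-1) ^ (m + n) * cexp (-(π * I * m ^ 2 * τ) - 2 * π * I * m * v) * kleinTheta τ v := by
  rw [← add_assoc, kleinTheta_add_int, kleinTheta_add_int_mul_tau, zpow_add₀ (by norm_num)]
  ring

/-- The zeros of the normalized theta function lie on the lattice `ℤ τ + ℤ`. -/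
lemma exists_of_kleinTheta_eq_zero {τ : ℍ} {v : ℂ} (h : kleinTheta τ v = 0) :
    ∃ m n : ℤ, v = m * τ + n := by
  have hpi : (2 * π * I : ℂ) ≠ 0 := by simp [Real.pi_ne_zero]
  have hq := norm_nome_lt_one τ
  have key : ∀ a : ℤ, cexp (2 * π * I * (v + a * τ)) = 1 → ∃ m n : ℤ, v = m * τ + n := by
    intro a ha
    obtain ⟨n, hn⟩ := Complex.exp_eq_one_iff.1 ha
    refine ⟨-a, n, mul_left_cancel₀ hpi ?_⟩
    push_cast
    linear_combination hn
  by_contra hv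
  have h1 : qPoch (cexp (2 * π * I * v)) (nome τ) ≠ 0 := by
    refine qPoch_ne_zero hq fun n hn => hv (key n ?_)
    rw [← hn, nome, ← Complex.exp_nat_mul, ← Complex.exp_add]
    push_cast; ring_nf
  have h2 : qPoch (nome τ * cexp (-(2 * π * I * v))) (nome τ) ≠ 0 := by
    refine qPoch_ne_zero hq fun n hn => hv (key (-(n + 1)) ?_)
    rw [← inv_eq_one, ← Complex.exp_neg, ← hn, nome, ← Complex.exp_nat_mul, ← Complex.exp_add,
      ← Complex.exp_add]
    push_cast; ring_nf
  exact div_ne_zero (mul_ne_zero (Complex.exp_ne_zero _) (mul_ne_zero h1 h2))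
    (pow_ne_zero 2 (qPoch_nome_ne_zero τ)) h

/-! ### Modular transformation of the normalized theta function -/

/-- A doubly periodic entire function is constant. -/
lemma apply_eq_apply_of_doubly_periodic (τ : ℍ) {G : ℂ → ℂ} (hG : Differentiable ℂ G)
    (h1 : Function.Periodic G 1) (hτ : Function.Periodic G τ) (v w : ℂ) : G v = G w := by
  refine hG.apply_eq_apply_of_bounded (((isCompact_closedBall (0 : ℂ) (‖(τ : ℂ)‖ + 1)).image
    hG.continuous).isBounded.subset ?_) v w
  rintro _ ⟨u, rfl⟩
  -- Reduce `u = s τ + t`, with `s` and `t` real, to the fundamental parallelogram.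
  set s : ℝ := u.im / τ.im with hs
  set t : ℝ := u.re - s * τ.re with ht
  have hu : u = s * τ + t := by
    apply Complex.ext
    · simp [ht]
    · simp [hs, τ.im_ne_zero]
  refine ⟨u - ⌊s⌋ * τ - ⌊t⌋ * 1, ?_, ?_⟩
  · have e : u - ⌊s⌋ * τ - ⌊t⌋ * 1 = (Int.fract s : ℝ) * τ + (Int.fract t : ℝ) := by
      rw [hu, ← Int.self_sub_floor, ← Int.self_sub_floor]
      push_cast
      ring
    rw [mem_closedBall_zero_iff, e]
    refine (norm_add_le _ _).trans (add_le_add ?_ ?_)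
    · rw [norm_mul, Complex.norm_real, Real.norm_of_nonneg (Int.fract_nonneg s)]
      exact mul_le_of_le_one_left (norm_nonneg _) (Int.fract_lt_one s).le
    · rw [Complex.norm_real, Real.norm_of_nonneg (Int.fract_nonneg t)]
      exact (Int.fract_lt_one t).le
  · rw [h1.sub_int_mul_eq ⌊t⌋, hτ.sub_int_mul_eq ⌊s⌋]

/-- Two entire functions with the same nowhere vanishing factors of quasi-periodicity along the
lattice `ℤ τ + ℤ`, both vanishing on the lattice, are proportional if one of them has only simple
zeros there and no other zeros. -/
lemma mul_eq_mul_of_quasiperiodic (τ : ℍ) {F D e₁ e₂ : ℂ → ℂ} {c d : ℂ}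
    (hF : Differentiable ℂ F) (hD : Differentiable ℂ D)
    (he₁ : ∀ v, e₁ v ≠ 0) (he₂ : ∀ v, e₂ v ≠ 0)
    (hF1 : ∀ v, F (v + 1) = e₁ v * F v) (hD1 : ∀ v, D (v + 1) = e₁ v * D v)
    (hFτ : ∀ v, F (v + τ) = e₂ v * F v) (hDτ : ∀ v, D (v + τ) = e₂ v * D v)
    (hF0 : F 0 = 0) (hD0 : D 0 = 0) (hFd : HasDerivAt F c 0) (hDd : HasDerivAt D d 0)
    (hd : d ≠ 0) (hDz : ∀ v, D v = 0 → ∃ m n : ℤ, v = m * τ + n) (v : ℂ) :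
    d * F v = c * D v := by
  classical
  -- The quotient `F / D`, with its limit `c / d` as the value at the zeros of `D`.
  set G : ℂ → ℂ := fun v => if D v = 0 then c / d else F v / D v with hG
  have hG1 : Function.Periodic G 1 := fun v => by
    simp only [hG, hF1, hD1, mul_eq_zero, he₁, false_or, mul_div_mul_left _ _ (he₁ v)]
  have hGτ : Function.Periodic G τ := fun v => by
    simp only [hG, hFτ, hDτ, mul_eq_zero, he₂, false_or, mul_div_mul_left _ _ (he₂ v)]
  -- At the origin both functions are divided by their simple zero.
  have hGdiff0 : DifferentiableAt ℂ G 0 := by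
    have hdF : DifferentiableAt ℂ (dslope F 0) 0 :=
      (Complex.differentiableOn_dslope univ_mem).2 hF.differentiableOn |>.differentiableAt univ_mem
    have hdD : DifferentiableAt ℂ (dslope D 0) 0 :=
      (Complex.differentiableOn_dslope univ_mem).2 hD.differentiableOn |>.differentiableAt univ_mem
    have hne : dslope D 0 0 ≠ 0 := by rwa [dslope_same, hDd.deriv]
    refine (hdF.div hdD hne).congr_of_eventuallyEq ?_
    filter_upwards [eventually_nhdsWithin_iff.1 (hDd.eventually_ne (c := 0) hd)] with v hv
    rcases eq_or_ne v 0 with rfl | hv0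
    · simp [hG, hD0, dslope_same, hFd.deriv, hDd.deriv]
    · simp only [hG, if_neg (hv hv0), Pi.div_apply, dslope_of_ne _ hv0, slope_def_field, hF0, hD0,
        sub_zero]
      field_simp
  have hGdiff : Differentiable ℂ G := fun v => by
    by_cases hv : D v = 0
    · obtain ⟨m, n, hmn⟩ := hDz v hv
      have e : G = fun u => G (u - v) := by
        funext u
        have := (hG1.int_mul n).sub_eq (u - m * τ)
        rw [(hGτ.int_mul m).sub_eq u] at this
        rw [← this, hmn, mul_one, sub_add_eq_sub_sub]
      rw [e]
      have h0 : DifferentiableAt ℂ G (v - v) := by rwa [sub_self]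
      exact h0.comp v (f := fun u => u - v) (by fun_prop)
    · refine ((hF v).div (hD v) hv).congr_of_eventuallyEq ?_
      filter_upwards [(hD v).continuousAt.eventually_ne hv] with u hu
      simp [hG, hu]
  by_cases hv : D v = 0
  · have p1 : Function.Periodic (fun v => F v = 0) 1 := fun v => by simp [hF1, he₁]
    have p2 : Function.Periodic (fun v => F v = 0) τ := fun v => by simp [hFτ, he₂]
    obtain ⟨m, n, rfl⟩ := hDz v hv
    have h := (p1.int_mul n) (m * τ)
    have h' := (p2.int_mul m) 0
    simp only [mul_one, zero_add] at h h'
    have hFv : F (m * τ + n) = 0 := by rw [h, h']; exact hF0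
    rw [hv, hFv, mul_zero, mul_zero]
  · have h := apply_eq_apply_of_doubly_periodic τ hGdiff hG1 hGτ v 0
    simp only [hG, if_neg hv, if_pos hD0] at h
    rw [div_eq_div_iff hv hd] at h
    linear_combination h

lemma neg_one_zpow_eq_exp (n : ℤ) : (-1 : ℂ) ^ n = cexp (π * I * n) := by
  rw [mul_comm, Complex.exp_int_mul, Complex.exp_pi_mul_I]

/-- Coprime integers `x` and `y` are not both even, so `(1 + x) (1 + y)` is even. -/
lemma neg_one_zpow_add_of_isCoprime {x y : ℤ} (hxy : IsCoprime x y) :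
    (-1 : ℂ) ^ (x + y) = -(-1) ^ (x * y) := by
  have h : Even ((1 + x) * (1 + y)) := by
    rw [Int.even_mul, Int.even_add, Int.even_add]
    by_contra hc
    simp only [Int.not_even_one, false_iff, not_or, not_not] at hc
    obtain ⟨u, v, huv⟩ := hxy
    have := (hc.1.mul_left u).add (hc.2.mul_left v)
    rw [huv] at this
    exact Int.not_even_one this
  have h1 : ((-1 : ℂ)) ^ ((1 + x) * (1 + y)) = 1 := h.neg_one_zpow
  have h2 : ((-1 : ℂ)) ^ (x * y) * (-1) ^ (x * y) = 1 := by
    rw [← zpow_add₀ (by norm_num)]; exact (Even.add_self _).neg_one_zpow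
  rw [show (1 + x) * (1 + y) = 1 + (x + y) + x * y by ring, zpow_add₀ (by norm_num),
    zpow_add₀ (by norm_num), zpow_one] at h1
  linear_combination (-(-1 : ℂ) ^ (x * y)) * h1 + (-(-1 : ℂ) ^ (x + y)) * h2

lemma coe_SL_smul (A : SL(2, ℤ)) (τ : ℍ) :
    ((A • τ : ℍ) : ℂ) = (A 0 0 * (τ : ℂ) + A 0 1) / (A 1 0 * (τ : ℂ) + A 1 1) := by
  rw [UpperHalfPlane.specialLinearGroup_apply]
  simp

lemma SL_denom_ne_zero (A : SL(2, ℤ)) (τ : ℍ) : (A 1 0 * (τ : ℂ) + A 1 1 : ℂ) ≠ 0 := by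
  have := UpperHalfPlane.denom_ne_zero A τ
  rwa [ModularGroup.denom_apply] at this

/-- The normalized theta function is a Jacobi form of weight `-1` and index `1 / 2`, with trivial
multiplier: both sides have the same factors of quasi-periodicity and the same simple zeros. -/
theorem kleinTheta_SL_smul (A : SL(2, ℤ)) (τ : ℍ) (v : ℂ) :
    kleinTheta (A • τ) (v / (A 1 0 * (τ : ℂ) + A 1 1))
      = (A 1 0 * (τ : ℂ) + A 1 1)⁻¹ * cexp (π * I * A 1 0 * v ^ 2 / (A 1 0 * (τ : ℂ) + A 1 1))
        * kleinTheta τ v := by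
  have hdet : A 0 0 * A 1 1 - A 0 1 * A 1 0 = 1 := by
    have := A.det_coe; rwa [Matrix.det_fin_two] at this
  have hw := SL_denom_ne_zero A τ
  have hτ' := coe_SL_smul A τ
  set τ' : ℍ := A • τ
  generalize A 0 0 = a, A 0 1 = b, A 1 0 = c, A 1 1 = d at *
  have hdetC : (a * d - b * c : ℂ) = 1 := by exact_mod_cast hdet
  set w : ℂ := c * (τ : ℂ) + d with hwdef
  have hpi : (2 * π * I : ℂ) ≠ 0 := by simp [Real.pi_ne_zero]
  -- In the scaled variable `v / w` the lattice `ℤ τ + ℤ` becomes `ℤ τ' + ℤ`.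
  have hinv : 1 / w = (-c : ℤ) * (τ' : ℂ) + (a : ℤ) := by
    rw [hτ']; field_simp; push_cast; rw [hwdef]; linear_combination -hdetC
  have hτw : τ / w = (d : ℤ) * (τ' : ℂ) + (-b : ℤ) := by
    rw [hτ']; field_simp; push_cast; rw [hwdef]; linear_combination -(τ : ℂ) * hdetC
  have hac : IsCoprime a c := ⟨d, -b, by linear_combination hdet⟩
  have hbd : IsCoprime b d := ⟨-c, a, by linear_combination hdet⟩
  have hdF : HasDerivAt (fun v => kleinTheta τ' (v / w)) (-(2 * π * I) / w) 0 := by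
    have h := hasDerivAt_kleinTheta_zero τ'
    have h2 : HasDerivAt (fun v : ℂ => v / w) (1 / w) 0 := (hasDerivAt_id (0 : ℂ)).div_const w
    rw [← zero_div w] at h
    have h3 := HasDerivAt.comp (0 : ℂ) h h2
    rwa [mul_one_div] at h3
  have hdD : HasDerivAt (fun v => cexp (π * I * c * v ^ 2 / w) * kleinTheta τ v)
      (-(2 * π * I)) 0 := by
    have h2 : DifferentiableAt ℂ (fun v : ℂ => cexp (π * I * c * v ^ 2 / w)) 0 := by fun_prop
    simpa [kleinTheta_zero] using h2.hasDerivAt.fun_mul (hasDerivAt_kleinTheta_zero τ)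
  have key := mul_eq_mul_of_quasiperiodic τ
    (F := fun v => kleinTheta τ' (v / w))
    (D := fun v => cexp (π * I * c * v ^ 2 / w) * kleinTheta τ v)
    (e₁ := fun v => -cexp (π * I * c * (2 * v + 1) / w))
    (e₂ := fun v => -cexp (π * I * c * (2 * v * τ + τ ^ 2) / w - (π * I * τ) - 2 * π * I * v))
    (c := -(2 * π * I) / w) (d := -(2 * π * I))
    ((differentiable_kleinTheta τ').comp (by fun_prop))
    (.mul (by fun_prop) (differentiable_kleinTheta τ))
    (fun v => neg_ne_zero.2 (Complex.exp_ne_zero _))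
    (fun v => neg_ne_zero.2 (Complex.exp_ne_zero _)) ?_ ?_ ?_ ?_
    (by simp [kleinTheta_zero]) (by simp [kleinTheta_zero]) hdF hdD
    (neg_ne_zero.2 hpi) ?_ v
  · apply mul_left_cancel₀ (neg_ne_zero.2 hpi)
    rw [key]
    ring
  · intro v
    rw [add_div, hinv, kleinTheta_add_lattice, show -c + a = a + c + 2 * (-c) by ring,
      zpow_add₀ (by norm_num), neg_one_zpow_add_of_isCoprime hac, zpow_mul (-1 : ℂ) 2,
      neg_one_zpow_eq_exp]
    norm_num
    left
    rw [← Complex.exp_add]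
    congr 1
    have e : π * I * c * (2 * v + 1) / w = π * I * c * (2 * (v / w) + 1 / w) := by ring
    rw [e, hinv]
    push_cast
    ring
  · intro v
    rw [kleinTheta_add_one, show π * I * c * (v + 1) ^ 2 / w
      = π * I * c * (2 * v + 1) / w + π * I * c * v ^ 2 / w by ring, Complex.exp_add]
    ring
  · intro v
    rw [add_div, hτw, kleinTheta_add_lattice, show d + -b = b + d + 2 * (-b) by ring,
      zpow_add₀ (by norm_num), neg_one_zpow_add_of_isCoprime hbd, zpow_mul (-1 : ℂ) 2,
      neg_one_zpow_eq_exp]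
    norm_num
    left
    rw [← Complex.exp_add]
    congr 1
    have e : π * I * c * (2 * v * τ + τ ^ 2) / w - π * I * τ - 2 * π * I * v
        = - (2 * π * I * d * (v / w)) - π * I * d * (τ / w) := by
      field_simp
      rw [hwdef]
      ring
    rw [e, hτw]
    push_cast
    ring
  · intro v
    rw [kleinTheta_add_tau, show π * I * c * (2 * v * τ + τ ^ 2) / w - π * I * τ - 2 * π * I * v
      = π * I * c * (2 * v * τ + τ ^ 2) / w + (-(π * I * τ) - 2 * π * I * v) by ring,
      show π * I * c * (v + τ) ^ 2 / w
      = π * I * c * (2 * v * τ + τ ^ 2) / w + π * I * c * v ^ 2 / w by ring, Complex.exp_add,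
      Complex.exp_add]
    ring
  · intro v hv
    exact exists_of_kleinTheta_eq_zero ((mul_eq_zero.1 hv).resolve_left (Complex.exp_ne_zero _))

/-! ### Transformation of the functions `f_{N,ρ}` under `Γ₀(N)` -/

/-- The point `N z` of the upper half-plane. -/
def natScale (N : ℕ) [NeZero N] (z : ℍ) : ℍ :=
  ⟨N * z, by simpa using mul_pos (Nat.cast_pos.2 (NeZero.pos N)) z.im_pos⟩

lemma coe_natScale (N : ℕ) [NeZero N] (z : ℍ) : (natScale N z : ℂ) = N * z := rfl

lemma nome_natScale (N : ℕ) [NeZero N] (z : ℍ) : nome (natScale N z) = qPow N z := by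
  rw [nome, qPow, coe_natScale, mul_assoc (2 * π * I)]

lemma eta_eq_qPoch (τ : ℍ) :
    ModularForm.eta τ = cexp (2 * π * I * τ / 24) * qPoch (nome τ) (nome τ) := by
  simp [ModularForm.eta, Function.Periodic.qParam, qPoch, nome, pow_succ']

lemma eta_SL_smul_pow (A : SL(2, ℤ)) (τ : ℍ) :
    ModularForm.eta (A • τ : ℍ) ^ 24
      = (A 1 0 * (τ : ℂ) + A 1 1) ^ 12 * ModularForm.eta τ ^ 24 := by
  have h := congrFun (SlashInvariantForm.slash_action_generators_SL2Z
    ModularForm.discriminant_S_invariant ModularForm.discriminant_T_invariant A) τ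
  rw [ModularForm.SL_slash_apply, ModularGroup.denom_apply] at h
  have hw := SL_denom_ne_zero A τ
  simp only [ModularForm.discriminant] at h
  rw [← h, zpow_neg]
  field_simp

/-- For every integer `ρ`, with `φ` the normalized theta function,
`f_{N,ρ}(z) = (-1) ^ ⌊ρ / N⌋ e ^ (π i ρ ^ 2 z / N) η(N z) ^ 3 φ(ρ z | N z)`. The sign makes up for
`f_{N,ρ}` being periodic in `ρ` while the other factors are only periodic up to sign. -/
lemma biagioliF_eq_kleinTheta (N : ℕ) [NeZero N] (ρ : ℤ) (z : ℍ) :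
    biagioliF N ρ z = (-1) ^ (ρ / N) * cexp (π * I * ρ ^ 2 * z / N)
      * ModularForm.eta (natScale N z) ^ 3 * kleinTheta (natScale N z) (ρ * z) := by
  have hN : (N : ℂ) ≠ 0 := NeZero.ne _
  have hρ : ρ = ρ % N + N * (ρ / N) := (Int.emod_add_mul_ediv ρ N).symm
  simp only [biagioliF]
  generalize hs : ρ % (N : ℤ) = s at *
  generalize ρ / (N : ℤ) = t at *
  subst hρ
  have hq := qPoch_nome_ne_zero (natScale N z)
  have e1 : ((s + N * t : ℤ) : ℂ) * z = s * z + t * (natScale N z : ℂ) := by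
    rw [coe_natScale]; push_cast; ring
  have e2 : ((-1 : ℂ)) ^ t * (-1) ^ t = 1 := by
    rw [← zpow_add₀ (by norm_num)]; exact (Even.add_self _).neg_one_zpow
  have e3 : cexp (2 * π * I * (s * z)) = qPow s z := by rw [qPow]; ring_nf
  have e4 : nome (natScale N z) * cexp (-(2 * π * I * (s * z))) = qPow (N - s) z := by
    rw [qPow, nome, coe_natScale, ← Complex.exp_add]; ring_nf
  rw [e1, kleinTheta_add_int_mul_tau, kleinTheta, eta_eq_qPoch, e3, e4]
  rw [← nome_natScale]
  have e5 : qPow ((N - 2 * s) ^ 2 / (8 * N)) z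
      = cexp (π * I * ((s + N * t : ℤ) : ℂ) ^ 2 * z / N)
        * cexp (2 * π * I * (natScale N z : ℂ) / 24) ^ 3
        * cexp (-(π * I * t ^ 2 * (natScale N z : ℂ)) - 2 * π * I * t * (s * z))
        * cexp (-(π * I * (s * z))) := by
    rw [qPow, ← Complex.exp_nat_mul, ← Complex.exp_add, ← Complex.exp_add, ← Complex.exp_add,
      coe_natScale]
    congr 1
    push_cast
    field_simp
    ring
  rw [e5, mul_pow]
  generalize qPoch (nome (natScale N z)) (nome (natScale N z)) = Q at *
  have e6 : Q ^ 3 * (Q ^ 2)⁻¹ = Q := by field_simp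
  generalize cexp (π * I * ((s + N * t : ℤ) : ℂ) ^ 2 * z / N) = E₁
  generalize cexp (2 * π * I * (natScale N z : ℂ) / 24) = E₂
  generalize cexp (-(π * I * t ^ 2 * (natScale N z : ℂ)) - 2 * π * I * t * (s * z)) = E₃
  generalize cexp (-(π * I * (s * z))) = E₄
  linear_combination (-(E₁ * E₂ ^ 3 * E₃ * E₄ * qPoch (qPow s z) (nome (natScale N z))
    * qPoch (qPow (N - s) z) (nome (natScale N z)))) * ((-1) ^ t * (-1) ^ t * e6 + Q * e2)

/-- The conjugate of a matrix in `Γ₀(N)` with lower left entry `N c` by `diag(N, 1)`. -/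
def scaleConj (N : ℕ) (A : SL(2, ℤ)) (c : ℤ) (hc : A 1 0 = N * c) : SL(2, ℤ) :=
  ⟨!![A 0 0, N * A 0 1; c, A 1 1], by
    have := A.det_coe
    rw [Matrix.det_fin_two] at this
    rw [Matrix.det_fin_two_of]
    linear_combination this + A 0 1 * hc⟩

lemma natScale_SL_smul (N : ℕ) [NeZero N] (A : SL(2, ℤ)) (c : ℤ) (hc : A 1 0 = N * c) (z : ℍ) :
    natScale N (A • z) = scaleConj N A c hc • natScale N z := by
  apply UpperHalfPlane.ext
  rw [coe_natScale, coe_SL_smul, coe_SL_smul, coe_natScale, hc]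
  simp only [scaleConj, Matrix.SpecialLinearGroup.coe_mk, Matrix.of_apply, Matrix.cons_val_zero,
    Matrix.cons_val_one, Matrix.cons_val', Matrix.cons_val_fin_one]
  push_cast
  ring

/-- The weight `-1` transformation of `f_{N,ρ}(z) / η(N z) ^ 3` under `Γ₀(N)`. -/
theorem biagioliF_SL_smul (N : ℕ) [NeZero N] (A : SL(2, ℤ)) (c : ℤ) (hc : A 1 0 = N * c)
    (ρ : ℤ) (z : ℍ) :
    biagioliF N ρ (A • z) = (-1) ^ (ρ * A 0 1 + ρ * A 0 0 / N + ρ / N)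
      * cexp (π * I * ρ ^ 2 * A 0 0 * A 0 1 / N) * (A 1 0 * (z : ℂ) + A 1 1)⁻¹
      * (ModularForm.eta (natScale N (A • z)) / ModularForm.eta (natScale N z)) ^ 3
      * biagioliF N (ρ * A 0 0) z := by
  have hN : (N : ℂ) ≠ 0 := NeZero.ne _
  have hdet : A 0 0 * A 1 1 - A 0 1 * A 1 0 = 1 := by
    have := A.det_coe; rwa [Matrix.det_fin_two] at this
  have hη := ModularForm.eta_ne_zero (natScale N z).2
  have hw := SL_denom_ne_zero A z
  rw [biagioliF_eq_kleinTheta, biagioliF_eq_kleinTheta]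
  generalize hη' : ModularForm.eta (natScale N (A • z)) = η'
  have h := kleinTheta_SL_smul (scaleConj N A c hc) (natScale N z)
    ((ρ * A 0 0 : ℤ) * z + (ρ * A 0 1 : ℤ))
  rw [← natScale_SL_smul, kleinTheta_add_int] at h
  simp only [scaleConj, Matrix.SpecialLinearGroup.coe_mk, Matrix.of_apply, Matrix.cons_val_zero,
    Matrix.cons_val_one, Matrix.cons_val', Matrix.cons_val_fin_one] at h
  have hcN : (c : ℂ) * (natScale N z : ℂ) = A 1 0 * z := by
    rw [coe_natScale, hc]; push_cast; ring
  have hv : (((ρ * A 0 0 : ℤ) : ℂ) * z + (ρ * A 0 1 : ℤ)) / (A 1 0 * z + A 1 1)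
      = ρ * ((A • z : ℍ) : ℂ) := by
    rw [coe_SL_smul]; push_cast; ring
  rw [hcN, hv] at h
  rw [h]
  have e2 : ((-1 : ℂ)) ^ (ρ * A 0 0 / N) * (-1) ^ (ρ * A 0 0 / N) = 1 := by
    rw [← zpow_add₀ (by norm_num)]; exact (Even.add_self _).neg_one_zpow
  have e3 : cexp (π * I * ρ ^ 2 * ((A • z : ℍ) : ℂ) / N)
      * cexp (π * I * c * (((ρ * A 0 0 : ℤ) : ℂ) * z + (ρ * A 0 1 : ℤ)) ^ 2
        / (A 1 0 * z + A 1 1))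
      = cexp (π * I * ρ ^ 2 * A 0 0 * A 0 1 / N)
        * cexp (π * I * ((ρ * A 0 0 : ℤ) : ℂ) ^ 2 * z / N) := by
    rw [← Complex.exp_add, ← Complex.exp_add, coe_SL_smul]
    congr 1
    have hdetC : (A 0 0 : ℂ) * A 1 1 - A 0 1 * A 1 0 = 1 := by exact_mod_cast hdet
    have hcC : (A 1 0 : ℂ) = N * c := by exact_mod_cast hc
    push_cast
    generalize hwdef : (A 1 0 : ℂ) * z + A 1 1 = w at *
    field_simp
    -- The identity reduces to `1 + c N (a z + b) = a (N c z + d)`.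
    linear_combination (-(ρ : ℂ) ^ 2 * (A 0 0 * z + A 0 1)) * hdetC
      - ρ ^ 2 * (A 0 0 * z + A 0 1) ^ 2 * hcC + ρ ^ 2 * A 0 0 * (A 0 0 * z + A 0 1) * hwdef
  have e4 : (η' / ModularForm.eta (natScale N z)) ^ 3 * ModularForm.eta (natScale N z) ^ 3
      = η' ^ 3 := by
    field_simp
  rw [zpow_add₀ (by norm_num), zpow_add₀ (by norm_num)]
  generalize η' / ModularForm.eta (natScale N z) = X at *
  generalize ModularForm.eta (natScale N z) = Y at *
  generalize kleinTheta (natScale N z) (((ρ * A 0 0 : ℤ) : ℂ) * z) = K at *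
  generalize ((A 1 0 : ℂ) * z + A 1 1)⁻¹ = w at *
  generalize cexp (π * I * ρ ^ 2 * A 0 0 * A 0 1 / N) = E₁ at *
  generalize cexp (π * I * ((ρ * A 0 0 : ℤ) : ℂ) ^ 2 * z / N) = E₂ at *
  linear_combination ((-1) ^ (ρ / (N : ℤ)) * (-1) ^ (ρ * A 0 1) * w * K)
    * (η' ^ 3 * e3 - E₁ * E₂ * ((-1) ^ (ρ * A 0 0 / N) * (-1) ^ (ρ * A 0 0 / N) * e4
      + η' ^ 3 * e2))

/-! ### Multiplicative independence of `η(p z)` and the functions `f_{p,k}` -/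

lemma biagioliF_ne_zero (N : ℕ) [NeZero N] {ρ : ℤ} (h : ¬ (N : ℤ) ∣ ρ) (z : ℍ) :
    biagioliF N ρ z ≠ 0 := by
  rw [biagioliF_eq_kleinTheta]
  refine mul_ne_zero (mul_ne_zero (mul_ne_zero (zpow_ne_zero _ (by norm_num))
    (Complex.exp_ne_zero _)) (pow_ne_zero _ (ModularForm.eta_ne_zero (natScale N z).2))) ?_
  intro h0
  obtain ⟨m, n, hmn⟩ := exists_of_kleinTheta_eq_zero h0
  rw [coe_natScale] at hmn
  have him : (ρ : ℝ) * z.im = m * (N * z.im) := by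
    simpa using congrArg Complex.im hmn
  rw [← mul_assoc] at him
  have h2 : (ρ : ℝ) = m * N := mul_right_cancel₀ z.im_ne_zero him
  exact h ⟨m, by rw [mul_comm]; exact_mod_cast h2⟩

lemma prod_one_sub_mul_pow_mem_Icc {x q : ℝ} (hx0 : 0 ≤ x) (hx1 : x ≤ 1) (hq0 : 0 ≤ q)
    (hq1 : q < 1) (n : ℕ) :
    ∏ i ∈ Finset.range n, (1 - x * q ^ i)
      ∈ Set.Icc (1 - x * ∑ i ∈ Finset.range n, q ^ i) 1 := by
  induction n with
  | zero => simp
  | succ n ih =>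
    have h0 : 0 ≤ x * q ^ n := by positivity
    have h1 : x * q ^ n ≤ 1 := mul_le_one₀ hx1 (by positivity) (pow_le_one₀ hq0 hq1.le)
    rw [Finset.prod_range_succ, Finset.sum_range_succ]
    constructor
    · nlinarith [ih.1, mul_nonneg h0 (sub_nonneg.2 ih.2)]
    · have hp : 0 ≤ ∏ i ∈ Finset.range n, (1 - x * q ^ i) := Finset.prod_nonneg fun i _ =>
        sub_nonneg.2 (mul_le_one₀ hx1 (by positivity) (pow_le_one₀ hq0 hq1.le))
      nlinarith [ih.2, mul_nonneg hp h0]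

lemma norm_qPoch_ofReal_mem_Icc {x q : ℝ} (hx0 : 0 ≤ x) (hx1 : x ≤ 1) (hq0 : 0 ≤ q)
    (hq1 : q < 1) : ‖qPoch x q‖ ∈ Set.Icc (1 - x / (1 - q)) 1 := by
  have hq : ‖(q : ℂ)‖ < 1 := by rwa [Complex.norm_real, Real.norm_of_nonneg hq0]
  have h := (multipliable_qPoch (x : ℂ) hq).hasProd.tendsto_prod_nat.norm
  refine isClosed_Icc.mem_of_tendsto h (.of_forall fun n => ?_)
  have e : ∏ i ∈ Finset.range n, (1 - (x : ℂ) * (q : ℂ) ^ i)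
      = ((∏ i ∈ Finset.range n, (1 - x * q ^ i) : ℝ) : ℂ) := by push_cast; rfl
  have hm := prod_one_sub_mul_pow_mem_Icc hx0 hx1 hq0 hq1 n
  have hp : 0 ≤ ∏ i ∈ Finset.range n, (1 - x * q ^ i) := Finset.prod_nonneg fun i _ =>
    sub_nonneg.2 (mul_le_one₀ hx1 (by positivity) (pow_le_one₀ hq0 hq1.le))
  rw [e, Complex.norm_real, Real.norm_of_nonneg hp]
  refine ⟨le_trans ?_ hm.1, hm.2⟩
  have hs : ∑ i ∈ Finset.range n, q ^ i ≤ (1 - q)⁻¹ := by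
    rw [← tsum_geometric_of_lt_one hq0 hq1]
    exact (summable_geometric_of_lt_one hq0 hq1).sum_le_tsum _ fun i _ => by positivity
  rw [div_eq_mul_inv]
  gcongr

lemma norm_qPoch_ofReal_le {x q : ℝ} (hx0 : 0 ≤ x) (hx1 : x ≤ 1) (hq0 : 0 ≤ q)
    (hq1 : q < 1) : ‖qPoch x q‖ ≤ 1 - x := by
  have hq : ‖(q : ℂ)‖ < 1 := by rwa [Complex.norm_real, Real.norm_of_nonneg hq0]
  have e : (1 - (x : ℂ)) = ((1 - x : ℝ) : ℂ) := by push_cast; rfl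
  rw [qPoch_eq_one_sub_mul _ hq, norm_mul, e, Complex.norm_real,
    Real.norm_of_nonneg (sub_nonneg.2 hx1), ← Complex.ofReal_mul]
  exact mul_le_of_le_one_right (sub_nonneg.2 hx1) (norm_qPoch_ofReal_mem_Icc (by positivity)
    (mul_le_one₀ hx1 hq0 hq1.le) hq0 hq1).2

lemma tendsto_pow_nhdsGT_zero {k : ℕ} (hk : 0 < k) :
    Tendsto (fun t : ℝ => t ^ k) (𝓝[>] 0) (𝓝 0) := by
  have := ((continuous_pow k).tendsto (0 : ℝ)).mono_left (nhdsWithin_le_nhds (s := Set.Ioi 0))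
  simpa [hk.ne'] using this

lemma tendsto_div_pow_of_lt {f : ℝ → ℝ} {d k : ℕ} {a : ℝ} (hk : k < d)
    (hf : Tendsto (fun t => f t / t ^ d) (𝓝[>] 0) (𝓝 a)) :
    Tendsto (fun t => f t / t ^ k) (𝓝[>] 0) (𝓝 0) := by
  have h1 := hf.mul (tendsto_pow_nhdsGT_zero (Nat.sub_pos_of_lt hk))
  rw [mul_zero] at h1
  refine h1.congr' ?_
  filter_upwards [self_mem_nhdsWithin] with t ht
  have ht' : t ≠ 0 := (Set.mem_Ioi.1 ht).ne'
  rw [pow_sub₀ t ht' hk.le]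
  field_simp

/-- `log (t ^ j; t ^ N)_∞ ~ -t ^ j` as `t → 0⁺`, from the elementary bounds
`1 - x / (1 - q) ≤ (x; q)_∞ ≤ 1 - x`. -/
lemma tendsto_log_norm_qPoch_div {j N : ℕ} (hj : 0 < j) (hN : 0 < N) :
    Tendsto (fun t : ℝ => Real.log ‖qPoch ((t ^ j : ℝ) : ℂ) ((t ^ N : ℝ) : ℂ)‖ / t ^ j)
      (𝓝[>] 0) (𝓝 (-1)) := by
  have hlow : Tendsto (fun t : ℝ => -(1 - t ^ N - t ^ j)⁻¹) (𝓝[>] 0) (𝓝 (-1)) := by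
    have h := (((tendsto_pow_nhdsGT_zero hN).const_sub 1).sub
      (tendsto_pow_nhdsGT_zero hj)).inv₀ (by norm_num)
    simpa using h.neg
  have hsmall : ∀ᶠ t : ℝ in 𝓝[>] 0, 0 < 1 - t ^ N - t ^ j :=
    (((tendsto_pow_nhdsGT_zero hN).const_sub 1).sub
      (tendsto_pow_nhdsGT_zero hj)).eventually (lt_mem_nhds (by norm_num))
  refine tendsto_of_tendsto_of_tendsto_of_le_of_le' hlow tendsto_const_nhds ?_ ?_
  all_goals
    filter_upwards [hsmall, self_mem_nhdsWithin] with t ht ht0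
    have hj0 : 0 < t ^ j := pow_pos ht0 j
    have hN0 : 0 < t ^ N := pow_pos ht0 N
    have hN1 : 0 < 1 - t ^ N := by linarith
    have h1 := (norm_qPoch_ofReal_mem_Icc hj0.le (by linarith) hN0.le (by linarith)).1
    have h2 := norm_qPoch_ofReal_le hj0.le (by linarith) hN0.le (by linarith : t ^ N < 1)
    have h3 : 0 < 1 - t ^ j / (1 - t ^ N) := by
      rw [sub_pos, div_lt_one hN1]; linarith
    set P := ‖qPoch ((t ^ j : ℝ) : ℂ) ((t ^ N : ℝ) : ℂ)‖
    have hP : 0 < P := h3.trans_le h1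
  · rw [le_div_iff₀ hj0]
    calc -(1 - t ^ N - t ^ j)⁻¹ * t ^ j = 1 - (1 - t ^ j / (1 - t ^ N))⁻¹ := by
          have e : 1 - t ^ j / (1 - t ^ N) = (1 - t ^ N - t ^ j) / (1 - t ^ N) := by
            field_simp
          rw [e, inv_div]
          field_simp
          ring
      _ ≤ 1 - P⁻¹ := by gcongr
      _ ≤ Real.log P := Real.one_sub_inv_le_log_of_pos hP
  · rw [div_le_iff₀ hj0]
    linarith [Real.log_le_sub_one_of_pos hP]

/-- Functions of the form `c log t - t ^ d + o(t ^ d)` as `t → 0⁺`, with distinct exponents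
`d > 0`, are linearly independent. -/
lemma eq_zero_of_sum_mul_eq_zero {ι : Type*} [Fintype ι] {d : ι → ℕ} (hd : d.Injective)
    (hd0 : ∀ i, 0 < d i) {L : ι → ℝ → ℝ} {c : ι → ℝ}
    (hL : ∀ i, Tendsto (fun t => (L i t - c i * Real.log t) / t ^ d i) (𝓝[>] 0) (𝓝 (-1)))
    {e : ι → ℝ} (h : ∀ᶠ t in 𝓝[>] (0 : ℝ), ∑ i, e i * L i t = 0) (i : ι) : e i = 0 := by
  -- Terms of order higher than `k` are negligible against `t ^ k`.
  have hhigh : ∀ i k, k < d i →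
      Tendsto (fun t => (L i t - c i * Real.log t) / t ^ k) (𝓝[>] 0) (𝓝 0) := fun i k hk =>
    tendsto_div_pow_of_lt hk (hL i)
  -- The logarithmic terms cancel, since `log t → -∞`.
  have hC : ∑ i, e i * c i = 0 := by
    have h1 : Tendsto (fun t => ∑ i, e i * ((L i t - c i * Real.log t) / t ^ 0)) (𝓝[>] 0)
        (𝓝 (∑ i : ι, e i * 0)) :=
      tendsto_finsetSum _ fun i _ => (hhigh i 0 (hd0 i)).const_mul _
    have h2 := (h1.div_atBot Real.tendsto_log_nhdsGT_zero).neg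
    rw [neg_zero] at h2
    refine tendsto_nhds_unique (tendsto_const_nhds.congr' ?_) h2
    filter_upwards [h, Real.tendsto_log_nhdsGT_zero.eventually_lt_atBot 0] with t ht hlog
    have e1 : ∑ i, e i * ((L i t - c i * Real.log t) / t ^ 0)
        = ∑ i, e i * L i t - (∑ i, e i * c i) * Real.log t := by
      rw [Finset.sum_mul, ← Finset.sum_sub_distrib]
      exact Finset.sum_congr rfl fun i _ => by ring
    rw [e1, ht, zero_sub, neg_div, neg_neg, mul_div_cancel_right₀ _ hlog.ne]
  by_contra hi
  obtain ⟨k, hk, hmin⟩ := Finset.exists_min_image (Finset.univ.filter fun i => e i ≠ 0) d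
    ⟨i, by simpa using hi⟩
  simp only [Finset.mem_filter, Finset.mem_univ, true_and] at hk hmin
  classical
  have h1 : Tendsto (fun t => ∑ i, e i * ((L i t - c i * Real.log t) / t ^ d k)) (𝓝[>] 0)
      (𝓝 (∑ i, if i = k then -e k else 0)) := by
    refine tendsto_finsetSum _ fun i _ => ?_
    split_ifs with hik
    · subst hik
      simpa using (hL i).const_mul (e i)
    · by_cases hei : e i = 0
      · simp [hei]
      · simpa using (hhigh i (d k) (lt_of_le_of_ne (hmin i hei)
          fun hdk => hik (hd hdk).symm)).const_mul (e i)
  rw [Finset.sum_ite_eq' Finset.univ k, if_pos (Finset.mem_univ k)] at h1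
  refine hk (neg_eq_zero.1 (tendsto_nhds_unique h1 (tendsto_const_nhds.congr' ?_)))
  filter_upwards [h] with t ht
  have e1 : ∑ i, e i * ((L i t - c i * Real.log t) / t ^ d k)
      = (∑ i, e i * L i t - (∑ i, e i * c i) * Real.log t) / t ^ d k := by
    rw [Finset.sum_mul, ← Finset.sum_sub_distrib, Finset.sum_div]
    exact Finset.sum_congr rfl fun i _ => by ring
  rw [e1, ht, hC]
  simp

/-- The point `z` of the imaginary axis with `e ^ (2 π i z) = t`, for `0 < t < 1`. -/
def axisPoint (t : ℝ) (ht : t ∈ Set.Ioo 0 1) : ℍ :=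
  ⟨(-Real.log t / (2 * π) : ℝ) * I, by
    rw [Complex.im_ofReal_mul, Complex.I_im, mul_one]
    exact div_pos (neg_pos.2 (Real.log_neg ht.1 ht.2)) Real.two_pi_pos⟩

lemma qPow_axisPoint {t : ℝ} (ht : t ∈ Set.Ioo 0 1) (x : ℂ) :
    qPow x (axisPoint t ht) = cexp (x * Real.log t) := by
  have h : (axisPoint t ht : ℂ) = (-Real.log t / (2 * π) : ℝ) * I := rfl
  have hpi : (π : ℂ) ≠ 0 := by simp [Real.pi_ne_zero]
  rw [qPow, h]
  congr 1
  push_cast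
  field_simp
  rw [I_sq]
  ring

lemma qPow_natCast_axisPoint {t : ℝ} (ht : t ∈ Set.Ioo 0 1) (k : ℕ) :
    qPow k (axisPoint t ht) = ((t ^ k : ℝ) : ℂ) := by
  rw [qPow_axisPoint, Complex.exp_nat_mul, ← Complex.ofReal_exp, Real.exp_log ht.1]
  push_cast
  rfl

lemma log_norm_qPow_axisPoint {t : ℝ} (ht : t ∈ Set.Ioo 0 1) (x : ℝ) :
    Real.log ‖qPow x (axisPoint t ht)‖ = x * Real.log t := by
  rw [qPow_axisPoint, ← Complex.ofReal_mul, Complex.norm_exp_ofReal, Real.log_exp]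

/-- The factors `η(p z)` and `f_{p,k}(z)` of a generalized eta-quotient. -/
def genEtaFactor (p : ℕ) (z : ℍ) : Fin ((p - 1) / 2 + 1) → ℂ :=
  Fin.cons (ModularForm.eta ((p : ℂ) * (z : ℂ))) fun i => biagioliF p ((i : ℕ) + 1 : ℤ) z

lemma genEtaQuot_eq_prod (p : ℕ) (n : ExpVec p) (z : ℍ) :
    genEtaQuot p n z = ∏ j, genEtaFactor p z j ^ n j := by
  rw [Fin.prod_univ_succ]
  rfl

lemma not_dvd_index {p : ℕ} (i : Fin ((p - 1) / 2)) : ¬ (p : ℤ) ∣ ((i : ℕ) + 1 : ℤ) := by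
  intro h
  have := Int.le_of_dvd (by omega) h
  have := i.isLt
  omega

lemma genEtaFactor_ne_zero (p : ℕ) [NeZero p] (z : ℍ) (j : Fin ((p - 1) / 2 + 1)) :
    genEtaFactor p z j ≠ 0 := by
  refine Fin.cases ?_ (fun i => ?_) j
  · exact ModularForm.eta_ne_zero (natScale p z).2
  · exact biagioliF_ne_zero p (not_dvd_index i) z

lemma log_norm_genEtaQuot (p : ℕ) [NeZero p] (n : ExpVec p) (z : ℍ) :
    Real.log ‖genEtaQuot p n z‖ = ∑ j, n j * Real.log ‖genEtaFactor p z j‖ := by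
  rw [genEtaQuot_eq_prod, norm_prod, Real.log_prod fun j _ =>
    norm_ne_zero_iff.2 (zpow_ne_zero _ (genEtaFactor_ne_zero p z j))]
  exact Finset.sum_congr rfl fun j _ => by rw [norm_zpow, Real.log_zpow]

lemma log_norm_eta_axisPoint (p : ℕ) [NeZero p] {t : ℝ} (ht : t ∈ Set.Ioo 0 1) :
    Real.log ‖ModularForm.eta ((p : ℂ) * (axisPoint t ht : ℂ))‖
      = (p / 24 : ℝ) * Real.log t
        + Real.log ‖qPoch ((t ^ p : ℝ) : ℂ) ((t ^ p : ℝ) : ℂ)‖ := by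
  have h := eta_eq_qPoch (natScale p (axisPoint t ht))
  have h0 := ModularForm.eta_ne_zero (natScale p (axisPoint t ht)).2
  rw [nome_natScale, qPow_natCast_axisPoint, coe_natScale] at h
  rw [coe_natScale, h] at h0
  rw [h, norm_mul, Real.log_mul (norm_ne_zero_iff.2 (left_ne_zero_of_mul h0))
    (norm_ne_zero_iff.2 (right_ne_zero_of_mul h0)), ← log_norm_qPow_axisPoint ht, qPow]
  congr 4
  push_cast
  ring

lemma log_norm_biagioliF_axisPoint (p : ℕ) [NeZero p] {k : ℕ} (hk0 : 0 < k) (hkp : k < p)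
    {t : ℝ} (ht : t ∈ Set.Ioo 0 1) :
    Real.log ‖biagioliF p k (axisPoint t ht)‖
      = ((p - 2 * k) ^ 2 / (8 * p) : ℝ) * Real.log t
        + (Real.log ‖qPoch ((t ^ k : ℝ) : ℂ) ((t ^ p : ℝ) : ℂ)‖
          + Real.log ‖qPoch ((t ^ (p - k) : ℝ) : ℂ) ((t ^ p : ℝ) : ℂ)‖
          + Real.log ‖qPoch ((t ^ p : ℝ) : ℂ) ((t ^ p : ℝ) : ℂ)‖) := by
  have hmod : (k : ℤ) % p = k := Int.emod_eq_of_lt (by omega) (by omega)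
  have hdvd : ¬ (p : ℤ) ∣ k := fun h => by
    have := Int.le_of_dvd (by omega) h
    omega
  have h0 := biagioliF_ne_zero p hdvd (axisPoint t ht)
  have hsub : ((p : ℂ) - k) = ((p - k : ℕ) : ℂ) := by rw [Nat.cast_sub hkp.le]
  simp only [biagioliF, hmod, Int.cast_natCast, hsub, qPow_natCast_axisPoint] at h0 ⊢
  have e : ((p : ℂ) - 2 * k) ^ 2 / (8 * p) = (((p - 2 * k) ^ 2 / (8 * p) : ℝ) : ℂ) := by
    push_cast; rfl
  rw [e] at h0 ⊢
  rw [← norm_ne_zero_iff] at h0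
  simp only [norm_mul, mul_ne_zero_iff] at h0
  obtain ⟨h1, ⟨h2, h3⟩, h4⟩ := h0
  rw [norm_mul, norm_mul, norm_mul, Real.log_mul h1 (by positivity),
    Real.log_mul (by positivity) h4, Real.log_mul h2 h3, log_norm_qPow_axisPoint]

/-- A generalized eta-quotient determines its exponents: on the imaginary axis, as
`t = e ^ (2 π i z) → 0⁺`, the logarithm of `f_{p,k}` is `c log t - t ^ k + o(t ^ k)` and that of
`η(p z)` is `c log t - t ^ p + o(t ^ p)`. -/
theorem genEtaQuot_injective (p : ℕ) [NeZero p] : Function.Injective (genEtaQuot p) := by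
  intro n n' hnn
  have hp : 0 < p := NeZero.pos p
  have hIoo : Set.Ioo (0 : ℝ) 1 ∈ 𝓝[>] (0 : ℝ) := Ioo_mem_nhdsGT one_pos
  have key := eq_zero_of_sum_mul_eq_zero
    (d := (Fin.cons p fun i => (i : ℕ) + 1 : Fin ((p - 1) / 2 + 1) → ℕ))
    (L := fun j t => if ht : t ∈ Set.Ioo (0 : ℝ) 1 then
      Real.log ‖genEtaFactor p (axisPoint t ht) j‖ else 0)
    (c := Fin.cons (p / 24 : ℝ) fun i => (p - 2 * ((i : ℕ) + 1 : ℕ)) ^ 2 / (8 * p))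
    (e := fun j => n j - n' j) ?_ ?_ ?_ ?_
  · funext j
    have := key j
    exact_mod_cast sub_eq_zero.1 this
  · rw [Fin.cons_injective_iff]
    refine ⟨?_, fun i j h => Fin.ext (by simpa using h)⟩
    rintro ⟨i, hi⟩
    have := i.isLt
    simp only at hi
    omega
  · intro j
    refine Fin.cases ?_ (fun i => ?_) j
    · exact hp
    · exact Nat.succ_pos _
  · intro j
    refine Fin.cases ?_ (fun i => ?_) j
    · refine (tendsto_log_norm_qPoch_div hp hp).congr' ?_
      filter_upwards [hIoo] with t ht
      simp only [dif_pos ht, Fin.cons_zero, genEtaFactor, log_norm_eta_axisPoint]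
      rw [add_sub_cancel_left]
    · have hi := i.isLt
      -- The factors `(t ^ (p - k); t ^ p)_∞` and `(t ^ p; t ^ p)_∞` are of higher order.
      have hzero : ∀ k : ℕ, (i : ℕ) + 1 < k →
          Tendsto (fun t : ℝ => Real.log ‖qPoch ((t ^ k : ℝ) : ℂ) ((t ^ p : ℝ) : ℂ)‖
            / t ^ ((i : ℕ) + 1)) (𝓝[>] 0) (𝓝 0) := fun k hk =>
        tendsto_div_pow_of_lt hk (tendsto_log_norm_qPoch_div (by omega) hp)
      have h1 := ((tendsto_log_norm_qPoch_div (j := (i : ℕ) + 1) (by omega) hp).add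
        (hzero (p - ((i : ℕ) + 1)) (by omega))).add (hzero p (by omega))
      rw [add_zero, add_zero] at h1
      refine h1.congr' ?_
      filter_upwards [hIoo] with t ht
      have h2 := log_norm_biagioliF_axisPoint p (k := (i : ℕ) + 1) (by omega) (by omega) ht
      rw [Nat.cast_succ (R := ℤ)] at h2
      simp only [dif_pos ht, Fin.cons_succ, genEtaFactor, h2]
      rw [add_sub_cancel_left, add_div, add_div]
  · filter_upwards [hIoo] with t ht
    simp only [dif_pos ht, sub_mul, Finset.sum_sub_distrib, ← log_norm_genEtaQuot, hnn, sub_self]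

/-! ### Generalized eta-quotients of weight one -/

/-- The root of unity produced by the factors `f_{p,k}`. The sign `(-1) ^ (a b ∑ k n_k)` in
`(-1) ^ L` stems from reducing `∑ k ^ 2 n_k` modulo `p` in `e ^ (π i a b ∑ k ^ 2 n_k / p)`. -/
lemma prod_root_of_unity {p : ℕ} (hodd : Odd (p : ℤ)) (n : ExpVec p) {m : ℤ} (a b : ℤ)
    (hm : (∑ i : Fin ((p - 1) / 2), ((i : ℕ) + 1 : ℤ) ^ 2 * n i.succ) ≡ 2 * m [ZMOD (p : ℤ)]) :
    ∏ i : Fin ((p - 1) / 2), ((-1 : ℂ) ^ (((i : ℕ) + 1 : ℤ) * b + ((i : ℕ) + 1 : ℤ) * a / (p : ℤ))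
        * cexp (π * I * (((i : ℕ) + 1 : ℤ) : ℂ) ^ 2 * a * b / p)) ^ n i.succ
      = (-1 : ℂ) ^ parityL p n a b * cexp (2 * π * I * a * b * m / p) := by
  have hp : (p : ℂ) ≠ 0 := by
    rintro h
    rw [Nat.cast_eq_zero.1 h] at hodd
    exact absurd hodd (by decide)
  obtain ⟨t, ht⟩ := hm.symm.dvd
  set K : ℤ := ∑ i : Fin ((p - 1) / 2), ((i : ℕ) + 1 : ℤ) * n i.succ with hK
  set T : ℤ := ∑ i : Fin ((p - 1) / 2), ((i : ℕ) + 1 : ℤ) ^ 2 * n i.succ with hT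
  set F : ℤ := ∑ i : Fin ((p - 1) / 2), (((i : ℕ) + 1 : ℤ) * a / (p : ℤ)) * n i.succ with hF
  have hKt : Even (K - t) := by
    have h1 : Even (T - K) := by
      rw [hT, hK, ← Finset.sum_sub_distrib]
      refine Finset.even_sum _ fun i _ => ?_
      have : Even (((i : ℕ) : ℤ) * ((i : ℕ) + 1)) := Int.even_mul_succ_self _
      rw [show ((i : ℕ) + 1 : ℤ) ^ 2 * n i.succ - ((i : ℕ) + 1 : ℤ) * n i.succ
        = (((i : ℕ) : ℤ) * ((i : ℕ) + 1)) * n i.succ by ring]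
      exact this.mul_right _
    have h2 : Even (((p : ℤ) - 1) * t) := (hodd.sub_odd odd_one).mul_right t
    rw [show K - t = ((p : ℤ) - 1) * t + 2 * m - (T - K) by linear_combination ht]
    exact (h2.add (even_two_mul m)).sub h1
  have hL : parityL p n a b = (b * K + F + a * b * t) + a * b * (K - t) := by
    rw [parityL, ← hK, ← hF]; ring
  rw [hL, zpow_add₀ (by norm_num), (hKt.mul_left (a * b)).neg_one_zpow, mul_one,
    neg_one_zpow_eq_exp, ← Complex.exp_add]
  simp only [neg_one_zpow_eq_exp, ← Complex.exp_add, ← Complex.exp_int_mul]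
  rw [← Complex.exp_sum]
  congr 1
  have e : ∀ i : Fin ((p - 1) / 2), (n i.succ : ℂ)
      * (π * I * ((((i : ℕ) + 1 : ℤ) * b + ((i : ℕ) + 1 : ℤ) * a / (p : ℤ) : ℤ) : ℂ)
        + π * I * (((i : ℕ) + 1 : ℤ) : ℂ) ^ 2 * a * b / p)
      = π * I * b * ((((i : ℕ) + 1 : ℤ) * n i.succ : ℤ) : ℂ)
        + π * I * (((((i : ℕ) + 1 : ℤ) * a / (p : ℤ)) * n i.succ : ℤ) : ℂ)
        + π * I * a * b / p * ((((i : ℕ) + 1 : ℤ) ^ 2 * n i.succ : ℤ) : ℂ) := fun i => by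
    push_cast
    ring
  simp only [e]
  rw [Finset.sum_add_distrib, Finset.sum_add_distrib, ← Finset.mul_sum, ← Finset.mul_sum,
    ← Finset.mul_sum, ← Int.cast_sum, ← Int.cast_sum, ← Int.cast_sum, ← hK, ← hT, ← hF,
    show T = 2 * m + p * t by linear_combination ht]
  push_cast
  field_simp
  ring

lemma zpow_sum_eq_prod {ι : Type*} {s : Finset ι} {y : ℂ} (hy : y ≠ 0) (f : ι → ℤ) :
    y ^ ∑ i ∈ s, f i = ∏ i ∈ s, y ^ f i := by
  classical
  induction s using Finset.induction_on with
  | empty => simp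
  | insert i s hi ih => rw [Finset.sum_insert hi, Finset.prod_insert hi, zpow_add₀ hy, ih]

/-- The transformation of a generalized eta-quotient under `Γ₀(p)` in weight one. The factor of automorphy `p z + d` of
the weight-one action cancels against the one coming from the eta-quotient. -/
theorem genEtaQuot_slash {p : ℕ} (hp : p.Prime) (hp3 : 3 < p) {m : ℤ} {n : ExpVec p}
    (hn : ModularityConditions m p n) {a b d : ℤ} {A : SL(2, ℤ)}
    (hA : (A : Matrix (Fin 2) (Fin 2) ℤ) = !![a, b; (p : ℤ), d]) (z : ℍ) :
    (genEtaQuot p n ∣[(1 : ℤ)] A) z =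
      (-1 : ℂ) ^ parityL p n a b
        * cexp (2 * π * I * (a : ℂ) * (b : ℂ) * (m : ℂ) / (p : ℂ))
        * (ModularForm.eta ((p : ℂ) * (z : ℂ)) ^ n 0
          * ∏ i : Fin ((p - 1) / 2), biagioliF p (((i : ℕ) + 1 : ℤ) * a) z ^ n i.succ) := by
  have : NeZero p := ⟨hp.ne_zero⟩
  obtain ⟨hn1, hn2, hn3⟩ := hn
  have h00 : A 0 0 = a := by simp [hA]
  have h01 : A 0 1 = b := by simp [hA]
  have h10 : A 1 0 = p := by simp [hA]
  have h11 : A 1 1 = d := by simp [hA]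
  have hc : A 1 0 = p * 1 := by rw [h10, mul_one]
  have hy := ModularForm.eta_ne_zero (natScale p z).2
  have hy' := ModularForm.eta_ne_zero (natScale p (A • z)).2
  have hw := SL_denom_ne_zero A z
  have hf := fun i : Fin ((p - 1) / 2) => biagioliF_SL_smul p A 1 hc ((i : ℕ) + 1 : ℤ) z
  have h24 := eta_SL_smul_pow (scaleConj p A 1 hc) (natScale p z)
  rw [← natScale_SL_smul] at h24
  simp only [scaleConj, Matrix.SpecialLinearGroup.coe_mk, Matrix.of_apply, Matrix.cons_val_zero,
    Matrix.cons_val_one, Matrix.cons_val', Matrix.cons_val_fin_one, coe_natScale,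
    h00, h01, h10, h11, Int.cast_one, one_mul, Int.cast_natCast] at h24 hf hy hy' hw
  rw [ModularForm.SL_slash_apply, ModularGroup.denom_apply, h10, h11, genEtaQuot]
  simp only [Int.cast_natCast]
  set w : ℂ := p * z + d
  set y : ℂ := ModularForm.eta (p * z)
  set y' : ℂ := ModularForm.eta (p * ((A • z : ℍ) : ℂ))
  set X : ℂ := y' / y with hX
  have hX0 : X ≠ 0 := div_ne_zero hy' hy
  have hX24 : X ^ 24 = w ^ 12 := by rw [hX, div_pow, h24]; field_simp
  have hy'X : y' = X * y := by rw [hX]; field_simp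
  set S : ℤ := ∑ i : Fin ((p - 1) / 2), n i.succ with hS
  -- The weights add up to one: `X` behaves like `w ^ (1 / 2)` as `24 ∣ n₀ + 3 S`.
  have hweight : X ^ n 0 * (w⁻¹ * X ^ 3) ^ S * w ^ (-1 : ℤ) = 1 := by
    obtain ⟨t, ht⟩ := hn3.symm.dvd
    have hXt : X ^ (n 0 + 3 * S) = w ^ (S + 1) := by
      rw [show n 0 + 3 * S = 24 * t by linear_combination ht, zpow_mul,
        show X ^ (24 : ℤ) = w ^ (12 : ℤ) by exact_mod_cast hX24, ← zpow_mul]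
      congr 1
      linarith
    rw [mul_zpow, inv_zpow', show (X ^ 3) ^ S = X ^ (3 * S) by rw [zpow_mul]; norm_cast,
      mul_left_comm, ← zpow_add₀ hX0, hXt, ← zpow_add₀ hw, ← zpow_add₀ hw,
      show -S + (S + 1) + -1 = 0 by ring, zpow_zero]
  have hk : ∀ i : Fin ((p - 1) / 2), ((i : ℕ) + 1 : ℤ) / (p : ℤ) = 0 := fun i => by
    have := i.isLt
    exact Int.ediv_eq_zero_of_lt (by omega) (by omega)
  have hodd : Odd (p : ℤ) := by exact_mod_cast hp.odd_of_ne_two (by omega)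
  have hprod : ∏ i : Fin ((p - 1) / 2), biagioliF p ((i : ℕ) + 1 : ℤ) (A • z) ^ n i.succ
      = (-1 : ℂ) ^ parityL p n a b * cexp (2 * π * I * a * b * m / p) * (w⁻¹ * X ^ 3) ^ S
        * ∏ i : Fin ((p - 1) / 2), biagioliF p (((i : ℕ) + 1 : ℤ) * a) z ^ n i.succ := by
    have hwX : w⁻¹ * X ^ 3 ≠ 0 := mul_ne_zero (inv_ne_zero hw) (pow_ne_zero 3 hX0)
    rw [← prod_root_of_unity hodd n a b hn2, hS, zpow_sum_eq_prod hwX,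
      ← Finset.prod_mul_distrib, ← Finset.prod_mul_distrib]
    refine Finset.prod_congr rfl fun i _ => ?_
    rw [hf i, hk i, add_zero, ← mul_zpow, ← mul_zpow]
    congr 1
    ring
  rw [hprod, hy'X, mul_zpow]
  linear_combination ((-1 : ℂ) ^ parityL p n a b * cexp (2 * π * I * a * b * m / p) * y ^ n 0
    * ∏ i : Fin ((p - 1) / 2), biagioliF p (((i : ℕ) + 1 : ℤ) * a) z ^ n i.succ) * hweight

lemma modularityConditions_permVec {p r : ℕ} (hp : p.Prime) (hp2 : 2 < p) (hr : ¬ p ∣ r)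
    {m m' : ℤ} {n : ExpVec p} (hn : ModularityConditions m p n)
    (hm : m' ≡ (r : ℤ) ^ 2 * m [ZMOD (p : ℤ)]) :
    ModularityConditions m' p (permVec p r n) := by
  obtain ⟨hn1, hn2, hn3⟩ := hn
  have hbij := piPerm_bijective hp hp2 hr
  have hsum : ∑ i : Fin ((p - 1) / 2), permVec p r n i.succ
      = ∑ i : Fin ((p - 1) / 2), n i.succ := by
    simp only [permVec, Fin.cons_succ]
    exact hbij.sum_comp fun i => n i.succ
  refine ⟨by rwa [hsum], ?_, by rwa [hsum]⟩
  have hterm : ∀ i ∈ (Finset.univ : Finset (Fin ((p - 1) / 2))), ((i : ℕ) + 1 : ℤ) ^ 2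
      * permVec p r n i.succ ≡ (r : ℤ) ^ 2 * (((piPerm p r i : ℕ) + 1 : ℤ) ^ 2
        * n (piPerm p r i).succ) [ZMOD (p : ℤ)] := fun i _ => by
    rw [← mul_assoc, ← mul_pow]
    simp only [permVec, Fin.cons_succ]
    refine Int.ModEq.mul_right _ (Int.ModEq.symm ?_)
    rcases piPerm_spec hp hp2 hr i with h | h
    · exact h.pow 2
    · have h2 := h.pow 2
      rwa [neg_sq] at h2
  have h1 := Int.ModEq.sum hterm
  rw [← Finset.mul_sum, hbij.sum_comp fun i : Fin ((p - 1) / 2) =>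
    ((i : ℕ) + 1 : ℤ) ^ 2 * n i.succ] at h1
  refine (h1.trans (hn2.mul_left _)).trans ?_
  rw [mul_left_comm]
  exact (hm.symm.mul_left 2)

end

theorem mainTheorem6 (p : ℕ) (hp : p.Prime) (hp3 : 3 < p)
    (m : ℤ) (hm0 : 0 ≤ m) (hm1 : m ≤ (p : ℤ) - 1)
    (n : ExpVec p) (hj : genEtaQuot p n ∈ frakF m p) :
    (∀ (a b d : ℤ) (A : SL(2, ℤ)),
      (A : Matrix (Fin 2) (Fin 2) ℤ) = !![a, b; (p : ℤ), d] →
      1 ≤ a → a ≤ (p : ℤ) - 1 → 1 ≤ d → d ≤ (p : ℤ) - 1 →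
      ∀ z : UpperHalfPlane,
        (genEtaQuot p n ∣[(1 : ℤ)] A) z =
          (-1 : ℂ) ^ parityL p n a b
            * Complex.exp (2 * Real.pi * Complex.I * (a : ℂ) * (b : ℂ) * (m : ℂ) / (p : ℂ))
            * (ModularForm.eta ((p : ℂ) * (z : ℂ)) ^ n 0
              * ∏ i : Fin ((p - 1) / 2),
                  biagioliF p (((i : ℕ) + 1 : ℤ) * a) z ^ n i.succ)) ∧
    (∀ (r : ℕ) (m' : ℤ), 1 ≤ r → r ≤ (p - 1) / 2 →
      m' ≡ (r : ℤ) ^ 2 * m [ZMOD (p : ℤ)] →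
      genEtaQuot p (permVec p r n) ∈ frakF m' p) := by
  have : NeZero p := ⟨hp.ne_zero⟩
  -- Membership concerns the function only; its exponents are recovered by injectivity.
  obtain ⟨n', hn', hnn'⟩ := hj
  obtain rfl := genEtaQuot_injective p hnn'
  refine ⟨fun a b d A hA _ _ _ _ z => genEtaQuot_slash hp hp3 hn' hA z, fun r m' hr1 hr2 hm =>
    ⟨_, modularityConditions_permVec hp (by omega) (fun h => ?_) hn' hm, rfl⟩⟩
  have := Nat.le_of_dvd hr1 h
  omega
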